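/- Let $H$ be a complex Hilbert space and let $(E_t)_{a\le t\le b}$ be a chain of orthogonal projections in $H$. A bounded operator $N$ on $H$ is *quasinilpotent* if $\sigma(N)\subseteq\{0\}$. A bounded operator $S$ is of *scalar type* if $S=\int_{\mathbb C}\lambda\,E(d\lambda)$ for a countably additive projection-valued spectral measure $E$ on the Borel sets of $\mathbb C$ (the projections need not be orthogonal) such that, for every Borel set $\delta$, $E(\delta)S=SE(\delta)$ and $\sigma(S|_{E(\delta)H})\subseteq\overline{\delta}$. A bounded operator $T$ is *$(S+V)$-triangular with respect to the chain $(E_t)$* if $T=S+V$, where $S$ is of scalar type, $V$ is compact and quasinilpotent, $$E_tS=SE_t,\qquad E_tVE_t=VE_t\qquad(a<t<b),$$ and the operators $(S-\lambda I)^{-1}V$, for every $\lambda\notin\sigma(S)$, and $(T-\lambda I)^{-1}V$, for every $\lambda\notin\sigma(T)$, are quasinilpotent. **Corollary 5.9.** Let $0<\omega<\infty$ and let $\alpha\neq0$ be real. The fractional integral of purely imaginary order $$(J^{i\alpha}f)(x)=\frac{1}{\Gamma(i\alpha+1)}\,\frac{d}{dx}\int_0^x(x-t)^{i\alpha}f(t)\,dt\quad\text{for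 almost every }x\in(0,\omega)$$ defines a unique bounded operator on $L^2(0,\omega)$, and this operator is not $(S+V)$-triangular with respect to the maximal chain of orthogonal projections $E_t$ $(0\le t\le\omega)$ given by $$(E_tf)(x)=0\quad(0<x<\omega-t),\qquad (E_tf)(x)=f(x)\quad(\omega-t<x<\omega).$$ -/

import Mathlib

open MeasureTheory Filter Topology

noncomputable section

namespace SVTriangular

section Operators

variable {H : Type*} [NormedAddCommGroup H] [InnerProductSpace ℂ H] [CompleteSpace H]

/-- A bounded operator is quasinilpotent if its spectrum is concentrated at zero. -/
def IsQuasinilpotent (N : H →L[ℂ] H) : Prop :=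
  spectrum ℂ N ⊆ {0}

/-- A (strongly countably additive) spectral measure on the Borel sets of `ℂ`. Its values are
projections by `inter`; they are not required to be orthogonal projections. -/
structure IsSpectralMeasure (E : Set ℂ → H →L[ℂ] H) : Prop where
  empty : E ∅ = 0
  univ : E Set.univ = 1
  inter : ∀ δ₁ δ₂ : Set ℂ, MeasurableSet δ₁ → MeasurableSet δ₂ → E (δ₁ ∩ δ₂) = E δ₁ * E δ₂
  iUnion : ∀ δ : ℕ → Set ℂ, (∀ n, MeasurableSet (δ n)) → Pairwise (Function.onFun Disjoint δ) →
    ∀ x : H, HasSum (fun n => E (δ n) x) (E (⋃ n, δ n) x)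

/-- The spectral measure `E` is the resolution of the identity for `S`: every `E δ` commutes with
`S`, and the restriction of `S` to the range of `E δ` has its spectrum in the closure of `δ`. -/
structure IsResolutionOfIdentity (E : Set ℂ → H →L[ℂ] H) (S : H →L[ℂ] H) : Prop where
  spectralMeasure : IsSpectralMeasure E
  commute : ∀ δ : Set ℂ, MeasurableSet δ → E δ * S = S * E δ
  spectrum_restrict : ∀ δ : Set ℂ, MeasurableSet δ →
    ∃ h : ∀ x ∈ LinearMap.range (E δ).toLinearMap, S x ∈ LinearMap.range (E δ).toLinearMap,
      spectrum ℂ (S.restrict h) ⊆ closure δ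

/-- The integral `∫ g dE = ∑ c, c E(g⁻¹{c})` of a simple function. -/
def simpleIntegral (E : Set ℂ → H →L[ℂ] H) (g : SimpleFunc ℂ ℂ) : H →L[ℂ] H :=
  ∑ c ∈ g.range, c • E (g ⁻¹' {c})

/-- `A = ∫ f dE` for an `E`-essentially bounded `f`: `A` is the limit in operator norm of the
integrals of simple functions which converge to `f` uniformly on a Borel set of full
`E`-measure. -/
def HasSpectralIntegral (E : Set ℂ → H →L[ℂ] H) (f : ℂ → ℂ) (A : H →L[ℂ] H) : Prop :=
  ∃ (g : ℕ → SimpleFunc ℂ ℂ) (δ : Set ℂ), MeasurableSet δ ∧ E δ = 1 ∧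
    TendstoUniformlyOn (fun n z => g n z) f atTop δ ∧
    Tendsto (fun n => simpleIntegral E (g n)) atTop (𝓝 A)

/-- `S` is of scalar type: `S = ∫ z E(dz)`, where `E` is the resolution of the identity for `S`. -/
def IsScalarType (S : H →L[ℂ] H) : Prop :=
  ∃ E : Set ℂ → H →L[ℂ] H, IsResolutionOfIdentity E S ∧ HasSpectralIntegral E (fun z => z) S

/-- `T = S + N` is an `(S + N)`-triangular representation of `T` with respect to the chain of
projections `E t`, `a ≤ t ≤ b`: `S` is of scalar type, `N` is quasinilpotent, the ranges of the
`E t` reduce `S` and are invariant under `N`, and `(S - z)⁻¹ N` (for `z ∉ σ(S)`) and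
`(T - z)⁻¹ N` (for `z ∉ σ(T)`) are quasinilpotent. -/
structure IsSNTriangularRep (E : ℝ → H →L[ℂ] H) (a b : ℝ) (T S N : H →L[ℂ] H) : Prop where
  eq_add : T = S + N
  scalarType : IsScalarType S
  quasinilpotent : IsQuasinilpotent N
  commute : ∀ t ∈ Set.Ioo a b, E t * S = S * E t
  triangular : ∀ t ∈ Set.Ioo a b, E t * N * E t = N * E t
  condA : ∀ z ∈ resolventSet ℂ S,
    IsQuasinilpotent (Ring.inverse (S - algebraMap ℂ (H →L[ℂ] H) z) * N)
  condB : ∀ z ∈ resolventSet ℂ T,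
    IsQuasinilpotent (Ring.inverse (T - algebraMap ℂ (H →L[ℂ] H) z) * N)

/-- `T` is `(S + N)`-triangular with respect to the chain `E t`, `a ≤ t ≤ b`. -/
def IsSNTriangular (E : ℝ → H →L[ℂ] H) (a b : ℝ) (T : H →L[ℂ] H) : Prop :=
  ∃ S N : H →L[ℂ] H, IsSNTriangularRep E a b T S N

/-- `T` is `(S + V)`-triangular with respect to the chain `E t`, `a ≤ t ≤ b`: it is
`(S + N)`-triangular and the corresponding quasinilpotent operator is compact. -/
def IsSVTriangular (E : ℝ → H →L[ℂ] H) (a b : ℝ) (T : H →L[ℂ] H) : Prop :=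
  ∃ S V : H →L[ℂ] H, IsSNTriangularRep E a b T S V ∧ IsCompactOperator V

end Operators

/-- The complex Hilbert space `L²(0, ω)`. -/
abbrev L2 (ω : ℝ) : Type := Lp ℂ 2 (volume.restrict (Set.Ioo 0 ω))

theorem memLp_indicator (ω t : ℝ) (f : L2 ω) :
    MemLp ((Set.Ioi (ω - t)).indicator f) 2 (volume.restrict (Set.Ioo 0 ω)) :=
  (Lp.memLp f).indicator measurableSet_Ioi

/-- Multiplication by the indicator function of `(ω - t, ∞)` on `L²(0, ω)`, as a linear map. -/
def chainProjLin (ω t : ℝ) : L2 ω →ₗ[ℂ] L2 ω where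
  toFun f := (memLp_indicator ω t f).toLp
  map_add' f g := by
    rw [← MemLp.toLp_add, MemLp.toLp_eq_toLp_iff]
    filter_upwards [Lp.coeFn_add f g] with x hx
    simp only [Set.indicator, Pi.add_apply, hx]
    split_ifs <;> simp
  map_smul' c f := by
    rw [RingHom.id_apply, ← MemLp.toLp_const_smul, MemLp.toLp_eq_toLp_iff]
    filter_upwards [Lp.coeFn_smul c f] with x hx
    simp only [Set.indicator, Pi.smul_apply, hx]
    split_ifs <;> simp

theorem chainProjLin_coeFn (ω t : ℝ) (f : L2 ω) :
    chainProjLin ω t f =ᵐ[volume.restrict (Set.Ioo 0 ω)] (Set.Ioi (ω - t)).indicator f :=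
  (memLp_indicator ω t f).coeFn_toLp

theorem norm_chainProjLin_le (ω t : ℝ) (f : L2 ω) : ‖chainProjLin ω t f‖ ≤ 1 * ‖f‖ := by
  rw [one_mul]
  refine Lp.norm_le_norm_of_ae_le ?_
  filter_upwards [chainProjLin_coeFn ω t f] with x hx
  rw [hx]
  exact norm_indicator_le_norm_self _ _

/-- The orthogonal projection `E_t` on `L²(0, ω)`: `(E_t f)(x) = 0` for `0 < x < ω - t` and
`(E_t f)(x) = f x` for `ω - t < x < ω`. -/
def chainProj (ω t : ℝ) : L2 ω →L[ℂ] L2 ω :=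
  (chainProjLin ω t).mkContinuous 1 (norm_chainProjLin_le ω t)

/-- The bounded operator `J` on `L²(0, ω)` is the fractional integral of order `iα`:
`(J f)(x) = 1 / Γ(iα + 1) * d/dx ∫ t in 0..x, (x - t) ^ (iα) f(t)` for almost every `x`. -/
def IsImaginaryFractionalIntegral (ω α : ℝ) (J : L2 ω →L[ℂ] L2 ω) : Prop :=
  ∀ f : L2 ω, ∀ᵐ x ∂(volume.restrict (Set.Ioo 0 ω)),
    HasDerivAt (fun y : ℝ => 1 / Complex.Gamma (Complex.I * α + 1) *
      ∫ t in (0 : ℝ)..y, ((y - t : ℝ) : ℂ) ^ (Complex.I * (α : ℂ)) * f t) (J f x) x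

end SVTriangular

end

/-! Non-triangularity is detected by the quadratic form `⟨e_ξ, T e_ξ⟩` on the characters `e_ξ(t) =
e^{2πiξt}` of `L²(0, ω)`. If `S` commutes with the chain, it commutes with multiplication by
characters, so `⟨e_ξ, S e_ξ⟩` does not depend on `ξ` (`inner_modVec_of_commute`). If `V` is compact,
`⟨e_ξ, V e_ξ⟩ → 0`, since `e_ξ` tends weakly to zero. Hence for `T = S + V` the limits along `ξ →
+∞` and `ξ → -∞` agree.

For the fractional integral they do not. Conjugation by `e^t` makes its adjoint a compressed Fourier
multiplier with bounded symbol `(1 - 2πiξ)^{iα}`; this yields both boundedness and, by Plancherel, a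
formula for the quadratic form (`inner_modVec_fracInt`). Along `ξ = ±ρ_n`, where `ρ_n → ∞` and
`ρ_n^{iα} = 1`, the form tends to `ω · conj((∓2πi)^{iα})`, of modulus `ω e^{±πα/2}`
(`tendsto_inner_modVec_fracInt`). The two moduli differ because `α ≠ 0`. -/

noncomputable section

open scoped ENNReal FourierTransform ComplexConjugate

namespace SVTriangular

/-! ### Fourier transform, multiplication and compact operators on `L²`. -/

section General

/-- On `L¹ ∩ L²` the Fourier transform on `L²` is given by the Fourier integral. -/
theorem fourier_toLp_ae_eq {f : ℝ → ℂ} (h1 : Integrable f) (h2 : MemLp f 2) :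
    (𝓕 (h2.toLp f) : Lp ℂ 2 (volume : Measure ℝ)) =ᵐ[volume] 𝓕 f := by
  refine ae_eq_of_integral_contDiff_smul_eq
    ((Lp.memLp _).locallyIntegrable (by norm_num)) ?_ ?_
  · have : Continuous (𝓕 f) := VectorFourier.fourierIntegral_continuous
      Real.continuous_fourierChar continuous_inner h1
    exact this.locallyIntegrable
  · intro g hg hgs
    have hgs' : HasCompactSupport (fun x => (g x : ℂ)) := hgs.comp_left Complex.ofReal_zero
    set G := hgs'.toSchwartzMap (Complex.ofRealCLM.contDiff.comp hg) with hG
    have hGx : ∀ x, G x = (g x : ℂ) := fun x => rfl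
    -- The `L²` transform agrees with the distributional one, so the transform moves onto the test
    -- function; the multiplication formula for integrable functions moves it back onto `f`.
    have key := congrArg (fun T => T G) (Lp.fourier_toTemperedDistribution_eq (h2.toLp f))
    simp only [TemperedDistribution.fourier_apply, Lp.toTemperedDistribution_apply] at key
    have e1 : ∫ x, (𝓕 G) x • (h2.toLp f) x = ∫ x, (𝓕 (G : ℝ → ℂ)) x • f x := by
      refine integral_congr_ae ?_
      filter_upwards [h2.coeFn_toLp] with x hx
      rw [hx, SchwartzMap.fourier_coe]
    have e2 : ∫ x, (𝓕 (G : ℝ → ℂ)) x • f x = ∫ x, G x • (𝓕 f) x :=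
      by simpa using! VectorFourier.integral_fourierIntegral_smul_eq_flip (L := innerₗ ℝ)
          Real.continuous_fourierChar continuous_inner G.integrable h1
    rw [e1, e2] at key
    simp only [hGx, smul_eq_mul] at key
    simp only [Complex.real_smul]
    exact key.symm

variable {X : Type*} [MeasurableSpace X] {μ : Measure X}

/-- Multiplication by an essentially bounded function, as an operator on `L²`. -/
def mulL : Lp ℂ ∞ μ →L[ℂ] Lp ℂ 2 μ →L[ℂ] Lp ℂ 2 μ :=
  (ContinuousLinearMap.mul ℂ ℂ).holderL μ ∞ 2 2

theorem mulL_coeFn (w : Lp ℂ ∞ μ) (f : Lp ℂ 2 μ) : mulL w f =ᵐ[μ] fun x => w x * f x :=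
  (ContinuousLinearMap.mul ℂ ℂ).coeFn_holder (r := 2) w f

theorem mulL_toLp_coeFn {w : X → ℂ} (hw : MemLp w ∞ μ) (f : Lp ℂ 2 μ) :
    mulL (hw.toLp w) f =ᵐ[μ] fun x => w x * f x := by
  filter_upwards [mulL_coeFn (hw.toLp w) f, hw.coeFn_toLp] with x h1 h2
  rw [h1, h2]

theorem norm_toLp_top_le {w : X → ℂ} (hw : MemLp w ∞ μ) {C : ℝ} (hC : 0 ≤ C)
    (h : ∀ᵐ x ∂μ, ‖w x‖ ≤ C) : ‖hw.toLp w‖ ≤ C := by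
  rw [Lp.norm_toLp, eLpNorm_exponent_top]
  exact ENNReal.toReal_le_of_le_ofReal hC (eLpNormEssSup_le_of_ae_bound h)

/-- A compact operator maps bounded weakly null sequences to sequences tending to zero. -/
theorem tendsto_zero_of_isCompactOperator {H : Type*} [NormedAddCommGroup H]
    [InnerProductSpace ℂ H] [CompleteSpace H] {V : H →L[ℂ] H} (hV : IsCompactOperator V)
    {u : ℕ → H} {C : ℝ} (hu : ∀ n, ‖u n‖ ≤ C)
    (hweak : ∀ g, Tendsto (fun n => inner ℂ g (u n)) atTop (𝓝 0)) :
    Tendsto (fun n => V (u n)) atTop (𝓝 0) := by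
  obtain ⟨K, hK, hKV⟩ := hV.image_closedBall_subset_compact C
  refine tendsto_of_subseq_tendsto fun ns hns => ?_
  obtain ⟨y, -, φ, hφ, hy⟩ := hK.tendsto_subseq (x := fun n => V (u (ns n)))
    fun n => hKV ⟨u (ns n), by simpa using hu _, rfl⟩
  refine ⟨φ, ?_⟩
  -- A norm limit of `V u` along a subsequence must vanish, because `⟨y, V u⟩ = ⟨V* y, u⟩ → 0`.
  have h0 : inner ℂ y y = 0 := by
    have h1 : Tendsto (fun n => inner ℂ y (V (u (ns (φ n))))) atTop (𝓝 (inner ℂ y y)) :=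
      tendsto_const_nhds.inner hy
    have h2 : Tendsto (fun n => inner ℂ y (V (u (ns (φ n))))) atTop (𝓝 0) := by
      simp_rw [← ContinuousLinearMap.adjoint_inner_left]
      exact (hweak _).comp (hns.comp hφ.tendsto_atTop)
    exact tendsto_nhds_unique h1 h2
  rw [inner_self_eq_zero] at h0
  rw [h0] at hy
  exact hy

/-- Extension by zero from `s` to the whole space. -/
def extendLp (μ : Measure X) (s : Set X) :
    Lp ℂ 2 (μ.restrict s) →L[ℂ] Lp ℂ 2 μ :=
  ContinuousLinearMap.adjoint (LpToLpRestrictCLM X ℂ ℂ μ 2 s)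

theorem extendLp_toLp {s : Set X} (hs : MeasurableSet s) {f : X → ℂ}
    (hf : MemLp f 2 (μ.restrict s)) :
    extendLp μ s (hf.toLp f) = ((memLp_indicator_iff_restrict hs).2 hf).toLp (s.indicator f) := by
  refine ext_inner_right ℂ fun h => ?_
  rw [extendLp, ContinuousLinearMap.adjoint_inner_left, L2.inner_def, L2.inner_def]
  have : ∀ᵐ x ∂μ, inner ℂ ((((memLp_indicator_iff_restrict hs).2 hf).toLp (s.indicator f)) x)
      (h x) = s.indicator (fun x => inner ℂ (f x) (h x)) x := by
    filter_upwards [((memLp_indicator_iff_restrict hs).2 hf).coeFn_toLp] with x hx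
    rw [hx]
    by_cases h : x ∈ s <;> simp [h]
  rw [integral_congr_ae this, integral_indicator hs]
  refine integral_congr_ae ?_
  filter_upwards [hf.coeFn_toLp, LpToLpRestrictCLM_coeFn ℂ s h] with x h1 h2
  rw [h1, h2]

theorem inner_toLp_toLp {f g : X → ℂ} (hf : MemLp f 2 μ) (hg : MemLp g 2 μ) :
    inner ℂ (hf.toLp f) (hg.toLp g) = ∫ x, conj (f x) * g x ∂μ := by
  rw [L2.inner_def]
  refine integral_congr_ae ?_
  filter_upwards [hf.coeFn_toLp, hg.coeFn_toLp] with x h1 h2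
  rw [h1, h2, RCLike.inner_apply, mul_comm]

end General

/-! ### Laplace transform of imaginary powers. -/

section Laplace

theorem norm_ofReal_cpow_I_mul {t : ℝ} (ht : 0 < t) (β : ℝ) :
    ‖(t : ℂ) ^ (Complex.I * (β : ℂ))‖ = 1 := by
  rw [Complex.norm_cpow_eq_rpow_re_of_pos ht]
  simp

theorem integrableOn_id_mul_exp_neg {δ : ℝ} (hδ : 0 < δ) :
    IntegrableOn (fun t : ℝ => t * Real.exp (-(δ * t))) (Set.Ioi 0) := by
  have := integrableOn_rpow_mul_exp_neg_mul_rpow (s := 1) (p := 1) (b := δ) (by norm_num)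
    one_pos hδ
  simpa using this

theorem measurable_cpow_I_mul_mul_exp (β : ℝ) (r : ℂ) :
    Measurable fun t : ℝ => (t : ℂ) ^ (Complex.I * (β : ℂ)) * Complex.exp (-(r * t)) := by
  fun_prop

theorem integrableOn_cpow_I_mul_mul_exp (β : ℝ) {r : ℂ} (hr : 0 < r.re) :
    IntegrableOn (fun t : ℝ => (t : ℂ) ^ (Complex.I * (β : ℂ)) * Complex.exp (-(r * t)))
      (Set.Ioi 0) := by
  refine Integrable.mono' (g := fun t => Real.exp (-r.re * t)) (exp_neg_integrableOn_Ioi 0 hr)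
    (measurable_cpow_I_mul_mul_exp β r).aestronglyMeasurable ?_
  filter_upwards [ae_restrict_mem measurableSet_Ioi] with t ht
  rw [norm_mul, norm_ofReal_cpow_I_mul ht, one_mul, Complex.norm_exp]
  simp

/-- Supplies the analyticity needed for the identity theorem. On the half plane `Re z > Re r / 2`
the differentiated integrand is dominated by `t e^{-(Re r / 2) t}`. -/
theorem hasDerivAt_laplace (β : ℝ) {r : ℂ} (hr : 0 < r.re) :
    HasDerivAt
      (fun r : ℂ => ∫ t in Set.Ioi (0 : ℝ),
        (t : ℂ) ^ (Complex.I * (β : ℂ)) * Complex.exp (-(r * t)))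
      (∫ t in Set.Ioi (0 : ℝ),
        (t : ℂ) ^ (Complex.I * (β : ℂ)) * (Complex.exp (-(r * t)) * (-t))) r := by
  refine (hasDerivAt_integral_of_dominated_loc_of_deriv_le (s := {z : ℂ | r.re / 2 < z.re})
    (F' := fun (r : ℂ) (t : ℝ) =>
      (t : ℂ) ^ (Complex.I * (β : ℂ)) * (Complex.exp (-(r * t)) * (-t)))
    (bound := fun t : ℝ => t * Real.exp (-(r.re / 2 * t)))
    ((isOpen_lt continuous_const Complex.continuous_re).mem_nhds (by simp; linarith))
    (Eventually.of_forall fun z => (measurable_cpow_I_mul_mul_exp β z).aestronglyMeasurable)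
    (integrableOn_cpow_I_mul_mul_exp β hr) ?_ ?_
    (integrableOn_id_mul_exp_neg (by positivity)) ?_).2
  · exact Measurable.aestronglyMeasurable (by fun_prop)
  · filter_upwards [ae_restrict_mem measurableSet_Ioi] with t ht z hz
    have ht' : (0 : ℝ) < t := ht
    rw [norm_mul, norm_ofReal_cpow_I_mul ht, one_mul, norm_mul, Complex.norm_exp, mul_comm,
      norm_neg, Complex.norm_real, Real.norm_of_nonneg ht'.le]
    gcongr
    have hz' : r.re / 2 < z.re := hz
    simp only [Complex.neg_re, Complex.mul_re, Complex.ofReal_re, Complex.ofReal_im, mul_zero,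
      sub_zero]
    nlinarith
  · filter_upwards with t z _
    have h : HasDerivAt (fun z : ℂ => -(z * (t : ℂ))) (-(t : ℂ)) z :=
      (hasDerivAt_mul_const (t : ℂ)).fun_neg
    exact h.cexp.const_mul _

/-- The Laplace transform of `t ↦ t ^ (iβ)` on the right half plane. -/
theorem integral_cpow_I_mul_mul_exp (β : ℝ) {r : ℂ} (hr : 0 < r.re) :
    ∫ t in Set.Ioi (0 : ℝ), (t : ℂ) ^ (Complex.I * (β : ℂ)) * Complex.exp (-(r * t)) =
      r ^ (-(Complex.I * (β : ℂ)) - 1) * Complex.Gamma (Complex.I * β + 1) := by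
  set U : Set ℂ := {z : ℂ | 0 < z.re}
  have hU : IsOpen U := isOpen_lt continuous_const Complex.continuous_re
  have hUc : IsPreconnected U := (convex_halfSpace_re_gt 0).isPreconnected
  have hf : AnalyticOnNhd ℂ (fun r : ℂ => ∫ t in Set.Ioi (0 : ℝ),
      (t : ℂ) ^ (Complex.I * (β : ℂ)) * Complex.exp (-(r * t))) U :=
    DifferentiableOn.analyticOnNhd
      (fun z hz => (hasDerivAt_laplace β hz).differentiableAt.differentiableWithinAt) hU
  have hg : AnalyticOnNhd ℂ (fun r : ℂ =>
      r ^ (-(Complex.I * (β : ℂ)) - 1) * Complex.Gamma (Complex.I * β + 1)) U := by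
    refine DifferentiableOn.analyticOnNhd (fun z hz => ?_) hU
    refine ((differentiableAt_id.cpow_const (Or.inl hz)).mul_const _).differentiableWithinAt
  have hreal : ∀ x : ℝ, 0 < x →
      ∫ t in Set.Ioi (0 : ℝ), (t : ℂ) ^ (Complex.I * (β : ℂ)) * Complex.exp (-((x : ℂ) * t)) =
      (x : ℂ) ^ (-(Complex.I * (β : ℂ)) - 1) * Complex.Gamma (Complex.I * β + 1) := by
    intro x hx
    have := Complex.integral_cpow_mul_exp_neg_mul_Ioi (a := Complex.I * β + 1) (r := x)
      (by simp) hx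
    rw [add_sub_cancel_right] at this
    rw [this, one_div, Complex.inv_cpow _ _ (by
      rw [Complex.arg_ofReal_of_nonneg hx.le]; exact Real.pi_pos.ne), ← Complex.cpow_neg, neg_add,
      sub_eq_add_neg]
  refine hf.eqOn_of_preconnected_of_frequently_eq hg hUc (z₀ := 1) (by simp [U]) ?_ hr
  -- Real points accumulating at `1` suffice for the identity theorem on the right half plane.
  have hlim : Tendsto (fun n : ℕ => ((1 + 1 / ((n : ℝ) + 1) : ℝ) : ℂ)) atTop (𝓝[≠] 1) := by
    refine tendsto_nhdsWithin_iff.2 ⟨?_, Eventually.of_forall fun n => ?_⟩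
    · have h1 : Tendsto (fun n : ℕ => (1 + 1 / ((n : ℝ) + 1) : ℝ)) atTop (𝓝 (1 + 0)) :=
        tendsto_const_nhds.add tendsto_one_div_add_atTop_nhds_zero_nat
      rw [add_zero] at h1
      exact (Complex.continuous_ofReal.tendsto 1).comp h1
    · have : (0 : ℝ) < 1 / ((n : ℝ) + 1) := by positivity
      simp only [Set.mem_compl_iff, Set.mem_singleton_iff, Complex.ofReal_eq_one]
      linarith
  exact hlim.frequently (Frequently.of_forall fun n => hreal _ (by positivity))

end Laplace

/-! ### Weighted half-line kernels and their Fourier transforms. -/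

section Kernel

theorem memLp_two_of_bounded {X : Type*} [MeasurableSpace X] {μ : Measure X} {f : X → ℂ}
    (hf : Integrable f μ) {C : ℝ} (h : ∀ᵐ x ∂μ, ‖f x‖ ≤ C) : MemLp f 2 μ := by
  rw [memLp_two_iff_integrable_sq_norm hf.1]
  simp_rw [pow_two]
  refine Integrable.bdd_mul hf.norm hf.1.norm (c := C) ?_
  filter_upwards [h] with x hx
  simpa using hx

/-- The function `t ↦ e ^ t (y - t)₊ ^ (iβ) / Γ(1 + iβ)`. -/
def kern (β y : ℝ) : ℝ → ℂ :=
  (Set.Iio y).indicator fun t => Complex.exp t *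
    (((y - t : ℝ) : ℂ) ^ (Complex.I * (β : ℂ)) / Complex.Gamma (Complex.I * β + 1))

theorem norm_kern_le (β y t : ℝ) :
    ‖kern β y t‖ ≤ (Set.Iic y).indicator
      (fun t => Real.exp t * ‖Complex.Gamma (Complex.I * β + 1)‖⁻¹) t := by
  by_cases h : t < y
  · rw [kern, Set.indicator_of_mem (by exact h), Set.indicator_of_mem (by exact h.le), norm_mul,
      norm_div, norm_ofReal_cpow_I_mul (sub_pos.2 h), Complex.norm_exp, one_div,
      Complex.ofReal_re]
  · rw [kern, Set.indicator_of_notMem (by exact h), norm_zero]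
    exact Set.indicator_nonneg (fun _ _ => by positivity) _

theorem measurable_kern (β y : ℝ) : Measurable (kern β y) :=
  Measurable.indicator (by fun_prop) measurableSet_Iio

theorem integrable_kern (β y : ℝ) : Integrable (kern β y) := by
  refine Integrable.mono' ?_ (measurable_kern β y).aestronglyMeasurable
    (Eventually.of_forall (norm_kern_le β y))
  exact (integrable_indicator_iff measurableSet_Iic).2 ((integrableOn_exp_Iic y).mul_const _)

theorem memLp_kern (β y : ℝ) : MemLp (kern β y) 2 := by
  refine memLp_two_of_bounded (integrable_kern β y)
    (C := Real.exp y * ‖Complex.Gamma (Complex.I * β + 1)‖⁻¹)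
    (Eventually.of_forall fun t => (norm_kern_le β y t).trans ?_)
  by_cases ht : t ≤ y
  · rw [Set.indicator_of_mem (by exact ht)]
    gcongr
  · rw [Set.indicator_of_notMem (by exact ht)]
    positivity

theorem one_sub_re (ξ : ℝ) : (1 - 2 * Real.pi * ξ * Complex.I : ℂ).re = 1 := by
  simp

/-- The substitution `t = y - s` gives the Laplace transform at `1 - 2πiξ`; the weight `e^t` is what
puts this point in the open right half plane. -/
theorem fourier_kern (β y ξ : ℝ) :
    𝓕 (kern β y) ξ = Complex.exp ((1 - 2 * Real.pi * ξ * Complex.I) * y) *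
      (1 - 2 * Real.pi * ξ * Complex.I : ℂ) ^ (-(Complex.I * (β : ℂ)) - 1) := by
  have hΓ : Complex.Gamma (Complex.I * β + 1) ≠ 0 :=
    Complex.Gamma_ne_zero_of_re_pos (by simp)
  set r : ℂ := 1 - 2 * Real.pi * ξ * Complex.I with hr
  have key := integral_cpow_I_mul_mul_exp β (r := r) (by rw [hr, one_sub_re]; norm_num)
  rw [Real.fourier_real_eq_integral_exp_smul, ← integral_sub_left_eq_self _ volume y]
  have : ∀ s : ℝ, Complex.exp (((-2 * Real.pi * (y - s) * ξ : ℝ) : ℂ) * Complex.I) •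
      kern β y (y - s) = (Set.Ioi (0 : ℝ)).indicator (fun s : ℝ =>
        (Complex.exp (r * y) / Complex.Gamma (Complex.I * β + 1)) *
        ((s : ℂ) ^ (Complex.I * (β : ℂ)) * Complex.exp (-(r * s)))) s := by
    intro s
    by_cases hs : 0 < s
    · rw [kern, Set.indicator_of_mem (by simpa using hs), Set.indicator_of_mem (by exact hs),
        sub_sub_cancel, smul_eq_mul, ← mul_assoc, ← Complex.exp_add]
      have e : (((-2 * Real.pi * (y - s) * ξ : ℝ) : ℂ) * Complex.I + ((y - s : ℝ) : ℂ)) =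
          r * y + -(r * s) := by
        rw [hr]; push_cast; ring
      rw [e, Complex.exp_add]
      ring
    · rw [kern, Set.indicator_of_notMem (by simpa using hs),
        Set.indicator_of_notMem (by exact hs), smul_zero]
  simp_rw [this]
  rw [integral_indicator measurableSet_Ioi, integral_const_mul, key]
  field_simp

end Kernel

/-! ### Construction and uniqueness of the fractional integral. -/

section Operator

/-- The Fourier symbol `ξ ↦ (1 - 2πiξ) ^ (iα)`. -/
def symb (α ξ : ℝ) : ℂ := (1 - 2 * Real.pi * ξ * Complex.I : ℂ) ^ (Complex.I * (α : ℂ))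

theorem one_sub_ne_zero (ξ : ℝ) : (1 - 2 * Real.pi * ξ * Complex.I : ℂ) ≠ 0 := fun h => by
  have := one_sub_re ξ
  rw [h] at this
  simp at this

theorem measurable_symb (α : ℝ) : Measurable (symb α) := by
  unfold symb
  fun_prop

theorem norm_symb_le (α ξ : ℝ) : ‖symb α ξ‖ ≤ Real.exp (Real.pi * |α|) := by
  rw [symb, Complex.norm_cpow_of_ne_zero (one_sub_ne_zero ξ)]
  simp only [Complex.mul_re, Complex.I_re, Complex.ofReal_re, zero_mul, Complex.I_im,
    Complex.ofReal_im, mul_zero, sub_self, Real.rpow_zero, Complex.mul_im, one_mul, zero_add]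
  rw [one_div, ← Real.exp_neg, Real.exp_le_exp]
  refine (neg_le_abs _).trans ?_
  rw [abs_mul]
  gcongr
  exact Complex.abs_arg_le_pi _

theorem memLp_symb (α : ℝ) : MemLp (symb α) ∞ (volume : Measure ℝ) :=
  memLp_top_of_bound (measurable_symb α).aestronglyMeasurable _
    (Eventually.of_forall (norm_symb_le α))

theorem fourier_kern_neg (α y ξ : ℝ) :
    𝓕 (kern (-α) y) ξ = symb α ξ * 𝓕 (kern 0 y) ξ := by
  rw [fourier_kern, fourier_kern, symb]
  have : (-(Complex.I * ((-α : ℝ) : ℂ)) - 1) =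
      Complex.I * (α : ℂ) + (-(Complex.I * ((0 : ℝ) : ℂ)) - 1) := by
    push_cast; ring
  rw [this, Complex.cpow_add _ _ (one_sub_ne_zero ξ)]
  ring

theorem memLp_top_exp_mul (ω c : ℝ) :
    MemLp (fun t : ℝ => ((Real.exp (c * t) : ℝ) : ℂ)) ∞ (volume.restrict (Set.Ioo 0 ω)) := by
  refine memLp_top_of_bound (Measurable.aestronglyMeasurable (by fun_prop))
    (Real.exp (|c| * ω)) ?_
  filter_upwards [ae_restrict_mem measurableSet_Ioo] with t ht
  rw [Complex.norm_real, Real.norm_of_nonneg (Real.exp_pos _).le, Real.exp_le_exp]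
  exact mul_le_mul (le_abs_self c) ht.2.le ht.1.le (abs_nonneg c)

/-- Multiplication by `t ↦ e ^ (ct)` on `L²(0, ω)`. -/
def mulExp (ω c : ℝ) : L2 ω →L[ℂ] L2 ω := mulL ((memLp_top_exp_mul ω c).toLp _)

theorem mulExp_coeFn (ω c : ℝ) (f : L2 ω) :
    mulExp ω c f =ᵐ[volume.restrict (Set.Ioo 0 ω)] fun t => ((Real.exp (c * t) : ℝ) : ℂ) * f t :=
  mulL_toLp_coeFn _ f

theorem mulExp_toLp {ω c : ℝ} {f g : ℝ → ℂ} (hf : MemLp f 2 (volume.restrict (Set.Ioo 0 ω)))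
    (hg : MemLp g 2 (volume.restrict (Set.Ioo 0 ω)))
    (h : ∀ t ∈ Set.Ioo 0 ω, g t = ((Real.exp (c * t) : ℝ) : ℂ) * f t) :
    mulExp ω c (hf.toLp f) = hg.toLp g := by
  refine Lp.ext ?_
  filter_upwards [mulExp_coeFn ω c (hf.toLp f), hf.coeFn_toLp, hg.coeFn_toLp,
    ae_restrict_mem measurableSet_Ioo] with t h1 h2 h3 h4
  rw [h1, h2, h3, h t h4]

theorem inner_mulExp (ω c : ℝ) (f g : L2 ω) :
    inner ℂ (mulExp ω c f) g = inner ℂ f (mulExp ω c g) := by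
  rw [L2.inner_def, L2.inner_def]
  refine integral_congr_ae ?_
  filter_upwards [mulExp_coeFn ω c f, mulExp_coeFn ω c g] with t h1 h2
  rw [h1, h2, RCLike.inner_apply, RCLike.inner_apply, map_mul, Complex.conj_ofReal]
  ring

/-- The Fourier multiplier with symbol `symb α`. -/
def fourierMul (α : ℝ) : Lp ℂ 2 (volume : Measure ℝ) →L[ℂ] Lp ℂ 2 (volume : Measure ℝ) :=
  (Lp.fourierTransformₗᵢ ℝ ℂ).symm.toContinuousLinearEquiv.toContinuousLinearMap ∘L
    mulL ((memLp_symb α).toLp _) ∘L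
    (Lp.fourierTransformₗᵢ ℝ ℂ).toContinuousLinearEquiv.toContinuousLinearMap

theorem fourier_fourierMul (α : ℝ) (f : Lp ℂ 2 (volume : Measure ℝ)) :
    (𝓕 (fourierMul α f) : Lp ℂ 2 (volume : Measure ℝ)) =
      mulL ((memLp_symb α).toLp _) (𝓕 f : Lp ℂ 2 (volume : Measure ℝ)) :=
  (Lp.fourierTransformₗᵢ ℝ ℂ).apply_symm_apply _

theorem fourierMul_kern (α y : ℝ) :
    fourierMul α ((memLp_kern 0 y).toLp _) = (memLp_kern (-α) y).toLp _ := by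
  apply (Lp.fourierTransformₗᵢ ℝ ℂ).injective
  change (𝓕 (fourierMul α _) : Lp ℂ 2 (volume : Measure ℝ)) =
    𝓕 ((memLp_kern (-α) y).toLp _)
  rw [fourier_fourierMul]
  refine Lp.ext ?_
  filter_upwards [mulL_toLp_coeFn (memLp_symb α)
      (𝓕 ((memLp_kern 0 y).toLp _) : Lp ℂ 2 (volume : Measure ℝ)),
    fourier_toLp_ae_eq (integrable_kern 0 y) (memLp_kern 0 y),
    fourier_toLp_ae_eq (integrable_kern (-α) y) (memLp_kern (-α) y)] with ξ h1 h2 h3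
  rw [h1, h2, h3, fourier_kern_neg]

/-- The adjoint of the fractional integral of order `iα`. -/
def fracAdj (ω α : ℝ) : L2 ω →L[ℂ] L2 ω :=
  mulExp ω (-1) ∘L LpToLpRestrictCLM ℝ ℂ ℂ volume 2 (Set.Ioo 0 ω) ∘L fourierMul α ∘L
    extendLp volume (Set.Ioo 0 ω) ∘L mulExp ω 1

theorem memLp_indicator_Iio (ω y : ℝ) :
    MemLp ((Set.Iio y).indicator fun _ => (1 : ℂ)) 2 (volume.restrict (Set.Ioo 0 ω)) :=
  (memLp_const 1).indicator measurableSet_Iio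

theorem kern_zero (y t : ℝ) :
    kern 0 y t = (Set.Iio y).indicator (fun t : ℝ => ((Real.exp t : ℝ) : ℂ)) t := by
  simp [kern]

/-- Writing the weighted indicator of `(0, y)` as a difference of half-line kernels makes the action
of the multiplier on it explicit. -/
theorem extendLp_mulExp_indicator {ω y : ℝ} (hy : y ∈ Set.Ioo 0 ω) :
    extendLp volume (Set.Ioo 0 ω) (mulExp ω 1 ((memLp_indicator_Iio ω y).toLp _)) =
      (memLp_kern 0 y).toLp _ - (memLp_kern 0 0).toLp _ := by
  have hk : MemLp (kern 0 y) 2 (volume.restrict (Set.Ioo 0 ω)) := (memLp_kern 0 y).restrict _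
  rw [mulExp_toLp _ hk, extendLp_toLp measurableSet_Ioo, ← MemLp.toLp_sub]
  · refine MemLp.toLp_congr _ _ ?_
    -- At `t = 0` the two sides differ: the kernels use `t < y` and `t < 0`, while the interval is
    -- open.
    have h0 : ∀ᵐ t : ℝ, t ≠ 0 := by simp [ae_iff, measure_singleton]
    filter_upwards [h0] with t ht
    simp only [Pi.sub_apply, Set.indicator, kern_zero, Set.mem_Ioo, Set.mem_Iio]
    rcases lt_or_gt_of_ne ht with h | h
    · simp [h, h.not_gt, h.trans hy.1]
    · by_cases h' : t < y
      · simp [h, h', h.not_gt, h'.trans hy.2]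
      · simp [h', h.not_gt]
  · intro t _
    rw [kern_zero, one_mul]
    by_cases h : t < y <;> simp [Set.indicator, h]

/-- The multiplier turns order `0` kernels into order `-iα` kernels; the one based at `0` vanishes
on `(0, ω)`, and the outer factor `e^{-t}` removes the weight. -/
theorem fracAdj_indicator {ω y : ℝ} (α : ℝ) (hy : y ∈ Set.Ioo 0 ω) :
    fracAdj ω α ((memLp_indicator_Iio ω y).toLp _) =ᵐ[volume.restrict (Set.Ioo 0 ω)]
      (Set.Iio y).indicator fun t : ℝ =>
        ((y - t : ℝ) : ℂ) ^ (Complex.I * ((-α : ℝ) : ℂ)) /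
          Complex.Gamma (Complex.I * ((-α : ℝ) : ℂ) + 1) := by
  simp only [fracAdj, ContinuousLinearMap.comp_apply, extendLp_mulExp_indicator hy, map_sub,
    fourierMul_kern]
  rw [← map_sub, ← map_sub, ← MemLp.toLp_sub]
  have hs := ((memLp_kern (-α) y).sub (memLp_kern (-α) 0)).coeFn_toLp
  filter_upwards [mulExp_coeFn ω (-1) (LpToLpRestrictCLM ℝ ℂ ℂ volume 2 (Set.Ioo 0 ω)
      (((memLp_kern (-α) y).sub (memLp_kern (-α) 0)).toLp _)),
    LpToLpRestrictCLM_coeFn ℂ (Set.Ioo 0 ω)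
      (((memLp_kern (-α) y).sub (memLp_kern (-α) 0)).toLp _),
    ae_restrict_of_ae hs, ae_restrict_mem measurableSet_Ioo] with t h1 h2 h3 h4
  rw [h1, h2, h3]
  simp only [Pi.sub_apply, kern, Set.indicator, Set.mem_Iio, h4.1.not_gt, if_false, sub_zero]
  by_cases h : t < y
  · simp only [h, if_true]
    rw [← mul_assoc, ← Complex.ofReal_exp, ← Complex.ofReal_mul, ← Real.exp_add]
    simp
  · simp [h]

/-- The fractional integral of order `iα` on `L²(0, ω)`. -/
def fracInt (ω α : ℝ) : L2 ω →L[ℂ] L2 ω := ContinuousLinearMap.adjoint (fracAdj ω α)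

theorem conj_cpow_div_gamma {s : ℝ} (hs : 0 < s) (α : ℝ) :
    conj ((s : ℂ) ^ (Complex.I * ((-α : ℝ) : ℂ)) /
      Complex.Gamma (Complex.I * ((-α : ℝ) : ℂ) + 1)) =
    1 / Complex.Gamma (Complex.I * α + 1) * (s : ℂ) ^ (Complex.I * (α : ℂ)) := by
  have harg : Complex.arg (s : ℂ) ≠ Real.pi := by
    rw [Complex.arg_ofReal_of_nonneg hs.le]; exact Real.pi_pos.ne
  have h1 : conj ((s : ℂ) ^ (Complex.I * ((-α : ℝ) : ℂ))) = (s : ℂ) ^ (Complex.I * (α : ℂ)) := by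
    have := Complex.cpow_conj (s : ℂ) (Complex.I * ((-α : ℝ) : ℂ)) harg
    rw [Complex.conj_ofReal] at this
    rw [← this]
    simp
  rw [map_div₀, h1, ← Complex.Gamma_conj]
  simp
  ring

theorem intervalIntegral_eq_inner {ω y : ℝ} (hy : y ∈ Set.Ioo 0 ω) (f : L2 ω) :
    ∫ t in (0 : ℝ)..y, f t = inner ℂ ((memLp_indicator_Iio ω y).toLp _) f := by
  rw [L2.inner_def, intervalIntegral.integral_of_le hy.1.le, integral_Ioc_eq_integral_Ioo,
    ← integral_indicator measurableSet_Ioo, ← integral_indicator measurableSet_Ioo]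
  refine integral_congr_ae ?_
  filter_upwards [(ae_restrict_iff' measurableSet_Ioo).1 (memLp_indicator_Iio ω y).coeFn_toLp]
    with t ht
  by_cases h : t ∈ Set.Ioo 0 ω
  · rw [Set.indicator_of_mem h, ht h]
    by_cases h' : t < y <;> simp [Set.indicator, h', h.1]
  · rw [Set.indicator_of_notMem h, Set.indicator_of_notMem]
    exact fun h' => h ⟨h'.1, h'.2.trans hy.2⟩

theorem intervalIntegral_fracInt {ω y : ℝ} (α : ℝ) (hy : y ∈ Set.Ioo 0 ω) (f : L2 ω) :
    ∫ t in (0 : ℝ)..y, fracInt ω α f t = 1 / Complex.Gamma (Complex.I * α + 1) *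
      ∫ t in (0 : ℝ)..y, ((y - t : ℝ) : ℂ) ^ (Complex.I * (α : ℂ)) * f t := by
  rw [intervalIntegral_eq_inner hy, fracInt, ContinuousLinearMap.adjoint_inner_right,
    L2.inner_def, intervalIntegral.integral_of_le hy.1.le, integral_Ioc_eq_integral_Ioo,
    ← integral_const_mul,
    ← integral_indicator measurableSet_Ioo, ← integral_indicator measurableSet_Ioo]
  refine integral_congr_ae ?_
  filter_upwards [(ae_restrict_iff' measurableSet_Ioo).1 (fracAdj_indicator α hy)]
    with t ht
  by_cases h : t ∈ Set.Ioo 0 ω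
  · rw [Set.indicator_of_mem h, ht h, RCLike.inner_apply]
    by_cases h' : t < y
    · rw [Set.indicator_of_mem (by exact h'), Set.indicator_of_mem (by exact ⟨h.1, h'⟩),
        conj_cpow_div_gamma (sub_pos.2 h')]
      ring
    · rw [Set.indicator_of_notMem (by exact h'), Set.indicator_of_notMem (fun h => h' h.2)]
      simp
  · rw [Set.indicator_of_notMem h, Set.indicator_of_notMem]
    exact fun h' => h ⟨h'.1, h'.2.trans hy.2⟩

/-- Near each interior point the function to be differentiated is the primitive of `fracInt ω α f`,
so Lebesgue differentiation applies. -/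
theorem isImaginaryFractionalIntegral_fracInt {ω : ℝ} (hω : 0 < ω) (α : ℝ) :
    IsImaginaryFractionalIntegral ω α (fracInt ω α) := by
  intro f
  have hint : IntervalIntegrable (fracInt ω α f) volume 0 ω := by
    rw [intervalIntegrable_iff_integrableOn_Ioo_of_le hω.le]
    exact (Lp.memLp _).integrable (by norm_num)
  rw [ae_restrict_iff' measurableSet_Ioo]
  filter_upwards [hint.ae_hasDerivAt_integral] with x hx hxω
  rw [Set.uIcc_of_le hω.le] at hx
  refine (hx ⟨hxω.1.le, hxω.2.le⟩ 0 ⟨le_rfl, hω.le⟩).congr_of_eventuallyEq ?_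
  filter_upwards [Ioo_mem_nhds hxω.1 hxω.2] with y hy
  exact (intervalIntegral_fracInt α hy f).symm

theorem IsImaginaryFractionalIntegral.unique {ω α : ℝ} {J J' : L2 ω →L[ℂ] L2 ω}
    (h : IsImaginaryFractionalIntegral ω α J) (h' : IsImaginaryFractionalIntegral ω α J') :
    J = J' := by
  ext1 f
  refine Lp.ext ?_
  filter_upwards [h f, h' f] with x h1 h2
  exact h1.unique h2

end Operator

/-! ### Operators commuting with the chain. -/

section Commutant

theorem memLp_top_indicator (ω s : ℝ) :
    MemLp ((Set.Ioi s).indicator fun _ => (1 : ℂ)) ∞ (volume.restrict (Set.Ioo 0 ω)) :=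
  (memLp_top_const 1).indicator measurableSet_Ioi

theorem chainProj_eq_mulL (ω s : ℝ) :
    chainProj ω (ω - s) = mulL ((memLp_top_indicator ω s).toLp _) := by
  ext1 f
  refine Lp.ext ?_
  filter_upwards [chainProjLin_coeFn ω (ω - s) f,
    mulL_toLp_coeFn (memLp_top_indicator ω s) f] with x h1 h2
  rw [h2]
  change chainProjLin ω (ω - s) f x = _
  rw [h1, sub_sub_cancel]
  by_cases h : s < x <;> simp [Set.indicator, h]

/-- The jumps telescope to the value of `u` at the last grid point strictly to the left of `x`,
whose index is `⌈x / δ⌉ - 1`. -/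
theorem sum_jumps_eq (u : ℝ → ℂ) {δ x : ℝ} (hδ : 0 < δ) (hx : 0 < x) {N : ℕ}
    (hxN : x ≤ (N + 1) * δ) :
    ∃ j : ℕ, |x - j * δ| ≤ δ ∧
      u 0 + ∑ k ∈ Finset.range N, (u ((k + 1 : ℕ) * δ) - u (k * δ)) *
        (Set.Ioi ((k + 1 : ℕ) * δ)).indicator (fun _ => (1 : ℂ)) x = u (j * δ) := by
  have hm : 0 < ⌈x / δ⌉₊ := Nat.ceil_pos.2 (by positivity)
  obtain ⟨j, hj⟩ := Nat.exists_eq_succ_of_ne_zero hm.ne'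
  have hlt : ∀ k : ℕ, (k : ℝ) * δ < x ↔ k ≤ j := fun k => by
    rw [← lt_div_iff₀ hδ, ← Nat.lt_ceil, hj, Nat.lt_succ_iff]
  have h1 : (j : ℝ) * δ < x := (hlt j).2 le_rfl
  have h2 : x ≤ (j + 1 : ℕ) * δ := not_lt.1 fun h => by
    have := (hlt (j + 1)).1 h
    omega
  push_cast at h2
  have hjN : j ≤ N := by
    by_contra! h
    have h3 : ((N + 1 : ℕ) : ℝ) * δ < x := (hlt (N + 1)).2 h
    push_cast at h3
    linarith
  refine ⟨j, abs_le.2 ⟨by linarith, by linarith⟩, ?_⟩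
  have hsum : ∑ k ∈ Finset.range N, (u ((k + 1 : ℕ) * δ) - u (k * δ)) *
      (Set.Ioi ((k + 1 : ℕ) * δ)).indicator (fun _ => (1 : ℂ)) x =
      ∑ k ∈ Finset.range j, (u ((k + 1 : ℕ) * δ) - u (k * δ)) := by
    rw [← Finset.sum_subset (Finset.range_mono hjN)]
    · refine Finset.sum_congr rfl fun k hk => ?_
      rw [Set.indicator_of_mem, mul_one]
      exact (hlt (k + 1)).2 (Finset.mem_range.1 hk)
    · intro k _ hk
      rw [Set.indicator_of_notMem, mul_zero]
      intro h
      exact hk (Finset.mem_range.2 ((hlt (k + 1)).1 h))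
  rw [hsum, Finset.sum_range_sub (fun k : ℕ => u (k * δ))]
  simp

/-- An operator which commutes with the chain `E_t` commutes with multiplication by every
bounded Lipschitz function. -/
theorem commute_mulL_of_commute_chainProj {ω : ℝ} (hω : 0 < ω) {S : L2 ω →L[ℂ] L2 ω}
    (hS : ∀ t ∈ Set.Ioo 0 ω, chainProj ω t * S = S * chainProj ω t) {u : ℝ → ℂ}
    (hu : MemLp u ∞ (volume.restrict (Set.Ioo 0 ω))) {L : NNReal} (hL : LipschitzWith L u) :
    mulL (hu.toLp u) * S = S * mulL (hu.toLp u) := by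
  -- The multipliers commuting with `S` are closed in `L^∞`, so it suffices to approximate `u`
  -- uniformly by step functions.
  set 𝒞 : Set (Lp ℂ ∞ (volume.restrict (Set.Ioo 0 ω))) := {w | mulL w * S = S * mulL w}
  have hclosed : IsClosed 𝒞 :=
    isClosed_eq ((mulL.continuous).mul continuous_const) (continuous_const.mul mulL.continuous)
  -- With `N + 1` cells the jump points `(k + 1) δ`, `k < N`, lie strictly inside `(0, ω)`, where
  -- commutation is assumed.
  set δ : ℕ → ℝ := fun N => ω / (N + 1) with hδ
  have hδ0 : ∀ N, 0 < δ N := fun N => by positivity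
  have hc : MemLp (fun _ : ℝ => (1 : ℂ)) ∞ (volume.restrict (Set.Ioo 0 ω)) := memLp_top_const 1
  set w : ℕ → Lp ℂ ∞ (volume.restrict (Set.Ioo 0 ω)) := fun N =>
    u 0 • hc.toLp _ + ∑ k ∈ Finset.range N, (u ((k + 1 : ℕ) * δ N) - u (k * δ N)) •
      (memLp_top_indicator ω ((k + 1 : ℕ) * δ N)).toLp _ with hw
  have hw𝒞 : ∀ N, w N ∈ 𝒞 := by
    intro N
    have h1 : mulL (hc.toLp _) = (1 : L2 ω →L[ℂ] L2 ω) := by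
      ext1 f
      refine Lp.ext ?_
      filter_upwards [mulL_toLp_coeFn hc f] with x hx
      rw [hx, one_mul]
      rfl
    change mulL (w N) * S = S * mulL (w N)
    simp only [hw, map_add, map_sum, map_smul, h1, add_mul, mul_add, Finset.sum_mul,
      Finset.mul_sum, smul_mul_assoc, mul_smul_comm, one_mul, mul_one]
    congr 1
    refine Finset.sum_congr rfl fun k hk => ?_
    rw [← chainProj_eq_mulL, hS]
    have hk' : ((k + 1 : ℕ) : ℝ) < N + 1 := by
      have := Finset.mem_range.1 hk
      exact_mod_cast Nat.succ_lt_succ this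
    have h2 : ((k + 1 : ℕ) : ℝ) * δ N < ω := by
      calc ((k + 1 : ℕ) : ℝ) * δ N < (N + 1) * δ N := mul_lt_mul_of_pos_right hk' (hδ0 N)
        _ = ω := by rw [hδ]; field_simp
    have h3 : 0 < ((k + 1 : ℕ) : ℝ) * δ N := mul_pos (by positivity) (hδ0 N)
    exact ⟨by linarith, by linarith⟩
  have hlim : Tendsto w atTop (𝓝 (hu.toLp u)) := by
    rw [tendsto_iff_norm_sub_tendsto_zero]
    have hδlim : Tendsto (fun N => L * δ N) atTop (𝓝 0) := by
      have := (tendsto_one_div_add_atTop_nhds_zero_nat (𝕜 := ℝ)).const_mul (L * ω)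
      rw [mul_zero] at this
      refine this.congr fun N => ?_
      rw [hδ]; ring
    refine squeeze_zero (fun _ => norm_nonneg _) (fun N => ?_) hδlim
    rw [← Lp.toLp_coeFn (w N) (Lp.memLp _), ← MemLp.toLp_sub]
    refine norm_toLp_top_le _ (mul_nonneg L.2 (hδ0 N).le) ?_
    have hind : ∀ᵐ x ∂(volume.restrict (Set.Ioo 0 ω)), ∀ k : ℕ,
        ((u ((k + 1 : ℕ) * δ N) - u (k * δ N)) •
          (memLp_top_indicator ω ((k + 1 : ℕ) * δ N)).toLp _ :
            Lp ℂ ∞ (volume.restrict (Set.Ioo 0 ω))) x =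
        (u ((k + 1 : ℕ) * δ N) - u (k * δ N)) *
          (Set.Ioi ((k + 1 : ℕ) * δ N)).indicator (fun _ => (1 : ℂ)) x := by
      rw [ae_all_iff]
      intro k
      filter_upwards [Lp.coeFn_smul (u ((k + 1 : ℕ) * δ N) - u (k * δ N))
        ((memLp_top_indicator ω ((k + 1 : ℕ) * δ N)).toLp _),
        (memLp_top_indicator ω ((k + 1 : ℕ) * δ N)).coeFn_toLp] with x h1 h2
      rw [h1, Pi.smul_apply, h2, smul_eq_mul]
    filter_upwards [Lp.coeFn_add (u 0 • hc.toLp _) (∑ k ∈ Finset.range N,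
        (u ((k + 1 : ℕ) * δ N) - u (k * δ N)) •
          (memLp_top_indicator ω ((k + 1 : ℕ) * δ N)).toLp _),
      Lp.coeFn_smul (u 0) (hc.toLp _), hc.coeFn_toLp,
      Lp.coeFn_finsetSum (Finset.range N) (fun k => (u ((k + 1 : ℕ) * δ N) - u (k * δ N)) •
          (memLp_top_indicator ω ((k + 1 : ℕ) * δ N)).toLp _), hind,
      ae_restrict_mem measurableSet_Ioo] with x h1 h2 h3 h4 h5 h6
    obtain ⟨j, hj1, hj2⟩ := sum_jumps_eq u (hδ0 N) h6.1 (N := N) (by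
      have : (N + 1) * δ N = ω := by rw [hδ]; field_simp
      rw [this]; exact h6.2.le)
    have hwx : w N x = u (j * δ N) := by
      rw [← hj2, hw]
      simp only
      rw [h1, Pi.add_apply, h2, Pi.smul_apply, h3, h4, Finset.sum_apply, smul_eq_mul, mul_one]
      congr 1
      exact Finset.sum_congr rfl fun k _ => h5 k
    rw [Pi.sub_apply, hwx, ← dist_eq_norm]
    refine (hL.dist_le_mul _ _).trans ?_
    rw [dist_comm, Real.dist_eq]
    gcongr
  exact hclosed.mem_of_tendsto hlim (Eventually.of_forall hw𝒞)

end Commutant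

/-! ### Characters on the interval. -/

section Modulation

/-- The character `t ↦ e ^ (2πiξt)`. -/
def modFun (ξ t : ℝ) : ℂ := Complex.exp ((2 * Real.pi * ξ * t : ℝ) * Complex.I)

theorem norm_modFun (ξ t : ℝ) : ‖modFun ξ t‖ = 1 := Complex.norm_exp_ofReal_mul_I _

theorem continuous_modFun (ξ : ℝ) : Continuous (modFun ξ) := by
  unfold modFun
  fun_prop

theorem lipschitzWith_modFun (ξ : ℝ) : ∃ L, LipschitzWith L (modFun ξ) := by
  refine ⟨‖2 * Real.pi * ξ‖₊, lipschitzWith_of_nnnorm_deriv_le (𝕜 := ℝ) ?_ ?_⟩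
  · unfold modFun
    fun_prop
  · intro t
    have h : HasDerivAt (fun t : ℝ => ((2 * Real.pi * ξ * t : ℝ) : ℂ) * Complex.I)
        (((2 * Real.pi * ξ : ℝ) : ℂ) * Complex.I) t :=
      ((hasDerivAt_const_mul (2 * Real.pi * ξ) : HasDerivAt _ _ t).ofReal_comp).mul_const _
    have h' : HasDerivAt (modFun ξ) (modFun ξ t * (((2 * Real.pi * ξ : ℝ) : ℂ) * Complex.I)) t :=
      h.cexp
    rw [h'.deriv, ← NNReal.coe_le_coe, coe_nnnorm, coe_nnnorm, norm_mul, norm_modFun, one_mul,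
      norm_mul, Complex.norm_I, mul_one, Complex.norm_real]

theorem memLp_modFun (ω ξ : ℝ) (p : ℝ≥0∞) :
    MemLp (modFun ξ) p (volume.restrict (Set.Ioo 0 ω)) :=
  MemLp.of_bound (continuous_modFun ξ).aestronglyMeasurable 1
    (Eventually.of_forall fun t => (norm_modFun ξ t).le)

/-- The unimodular exponential of frequency `ξ`, as an element of `L²(0, ω)`. -/
def modVec (ω ξ : ℝ) : L2 ω := (memLp_modFun ω ξ 2).toLp _

theorem mulL_modFun_modVec (ω ξ : ℝ) :
    mulL ((memLp_modFun ω ξ ∞).toLp _) (modVec ω 0) = modVec ω ξ := by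
  refine Lp.ext ?_
  filter_upwards [mulL_toLp_coeFn (memLp_modFun ω ξ ∞) (modVec ω 0),
    (memLp_modFun ω 0 2).coeFn_toLp, (memLp_modFun ω ξ 2).coeFn_toLp] with x h1 h2 h3
  rw [h1, modVec, modVec, h2, h3]
  simp [modFun]

theorem inner_mulL_modFun (ω ξ : ℝ) (f g : L2 ω) :
    inner ℂ (mulL ((memLp_modFun ω ξ ∞).toLp _) f) (mulL ((memLp_modFun ω ξ ∞).toLp _) g) =
      inner ℂ f g := by
  rw [L2.inner_def, L2.inner_def]
  refine integral_congr_ae ?_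
  filter_upwards [mulL_toLp_coeFn (memLp_modFun ω ξ ∞) f,
    mulL_toLp_coeFn (memLp_modFun ω ξ ∞) g] with x h1 h2
  rw [h1, h2, RCLike.inner_apply, RCLike.inner_apply, map_mul]
  have : modFun ξ x * conj (modFun ξ x) = 1 := by
    rw [Complex.mul_conj, Complex.normSq_eq_norm_sq, norm_modFun]
    simp
  linear_combination (g x * conj (f x)) * this

theorem norm_modVec (ω ξ : ℝ) : ‖modVec ω ξ‖ = ‖modVec ω 0‖ := by
  rw [← mulL_modFun_modVec ω ξ, norm_eq_sqrt_re_inner (𝕜 := ℂ), inner_mulL_modFun,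
    ← norm_eq_sqrt_re_inner (𝕜 := ℂ)]

/-- Multiplication by a character carries `e_0` to `e_ξ`, preserves inner products and commutes with
`S`. -/
theorem inner_modVec_of_commute {ω : ℝ} (hω : 0 < ω) {S : L2 ω →L[ℂ] L2 ω}
    (hS : ∀ t ∈ Set.Ioo 0 ω, chainProj ω t * S = S * chainProj ω t) (ξ : ℝ) :
    inner ℂ (modVec ω ξ) (S (modVec ω ξ)) = inner ℂ (modVec ω 0) (S (modVec ω 0)) := by
  obtain ⟨L, hL⟩ := lipschitzWith_modFun ξ
  have h := commute_mulL_of_commute_chainProj hω hS (memLp_modFun ω ξ ∞) hL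
  have h' := congrArg (fun A => A (modVec ω 0)) h
  simp only [mul_apply_eq_comp, mulL_modFun_modVec] at h'
  rw [← h', ← inner_mulL_modFun ω ξ (modVec ω 0), mulL_modFun_modVec]

/-- The exponentials tend weakly to zero as the frequency tends to infinity. -/
theorem tendsto_inner_modVec (ω : ℝ) (g : L2 ω) {ξ : ℕ → ℝ}
    (hξ : Tendsto ξ atTop (cocompact ℝ)) :
    Tendsto (fun n => inner ℂ g (modVec ω (ξ n))) atTop (𝓝 0) := by
  -- Riemann–Lebesgue at frequency `-ξ n`, since the Fourier kernel carries the opposite sign to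
  -- `modFun`.
  have h := (Real.tendsto_integral_exp_smul_cocompact
    ((Set.Ioo 0 ω).indicator fun t => conj (g t))).comp
    ((Homeomorph.neg ℝ).isClosedEmbedding.tendsto_cocompact.comp hξ)
  refine h.congr fun n => ?_
  rw [L2.inner_def, ← integral_indicator measurableSet_Ioo]
  refine integral_congr_ae ?_
  filter_upwards [(ae_restrict_iff' measurableSet_Ioo).1 (memLp_modFun ω (ξ n) 2).coeFn_toLp]
    with t ht
  by_cases h : t ∈ Set.Ioo 0 ω
  · rw [Set.indicator_of_mem h, Set.indicator_of_mem h, modVec, ht h, RCLike.inner_apply,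
      Circle.smul_def, Real.fourierChar_apply, smul_eq_mul, modFun]
    congr 4
    simp
    ring
  · simp [Set.indicator_of_notMem h]

end Modulation

/-! ### High-frequency limits of the quadratic form. -/

section Asymptotics

/-- The function `t ↦ e ^ (ct) e ^ (2πiξt)` on `(0, ω)`, extended by zero. -/
def box (ω c ξ : ℝ) : ℝ → ℂ :=
  (Set.Ioo 0 ω).indicator fun t => ((Real.exp (c * t) : ℝ) : ℂ) * modFun ξ t

theorem memLp_exp_mul_modFun (ω c ξ : ℝ) :
    MemLp (fun t => ((Real.exp (c * t) : ℝ) : ℂ) * modFun ξ t) 2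
      (volume.restrict (Set.Ioo 0 ω)) := by
  refine (memLp_congr_ae ?_).1 (Lp.memLp (mulExp ω c (modVec ω ξ)))
  filter_upwards [mulExp_coeFn ω c (modVec ω ξ), (memLp_modFun ω ξ 2).coeFn_toLp] with t h1 h2
  rw [h1, modVec, h2]

theorem memLp_box (ω c ξ : ℝ) : MemLp (box ω c ξ) 2 :=
  (memLp_indicator_iff_restrict measurableSet_Ioo).2 (memLp_exp_mul_modFun ω c ξ)

theorem integrable_box (ω c ξ : ℝ) : Integrable (box ω c ξ) :=
  (integrable_indicator_iff measurableSet_Ioo).2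
    ((memLp_exp_mul_modFun ω c ξ).integrable (by norm_num))

theorem extendLp_mulExp_modVec (ω c ξ : ℝ) :
    extendLp volume (Set.Ioo 0 ω) (mulExp ω c (modVec ω ξ)) = (memLp_box ω c ξ).toLp _ := by
  rw [modVec, mulExp_toLp _ (memLp_exp_mul_modFun ω c ξ) (fun _ _ => rfl),
    extendLp_toLp measurableSet_Ioo]
  rfl

theorem fourier_box (ω c ξ η : ℝ) : 𝓕 (box ω c ξ) η = 𝓕 (box ω c 0) (η - ξ) := by
  rw [Real.fourier_real_eq_integral_exp_smul, Real.fourier_real_eq_integral_exp_smul]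
  refine integral_congr_ae (Eventually.of_forall fun t => ?_)
  by_cases h : t ∈ Set.Ioo 0 ω
  · simp only [box, Set.indicator_of_mem h, smul_eq_mul, modFun]
    rw [mul_left_comm, ← Complex.exp_add, mul_left_comm, ← Complex.exp_add]
    congr 2
    push_cast
    ring
  · simp [box, Set.indicator_of_notMem h]

theorem fourier_toLp_box_ae_eq (ω c ξ : ℝ) :
    (𝓕 ((memLp_box ω c ξ).toLp _) : Lp ℂ 2 (volume : Measure ℝ)) =ᵐ[volume]
      fun η => 𝓕 (box ω c 0) (η - ξ) := by
  filter_upwards [fourier_toLp_ae_eq (integrable_box ω c ξ) (memLp_box ω c ξ)] with η h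
  rw [h, fourier_box]

/-- Plancherel, with the weights `e^t` and `e^{-t}` falling on opposite sides of the inner product.
Modulation by `ξ` translates both transforms, and shifting the variable moves `ξ` into the symbol
alone. -/
theorem inner_modVec_fracInt (ω α ξ : ℝ) :
    inner ℂ (modVec ω ξ) (fracInt ω α (modVec ω ξ)) =
      ∫ η, conj (symb α (η + ξ)) * (conj (𝓕 (box ω 1 0) η) * 𝓕 (box ω (-1) 0) η) := by
  rw [fracInt, ContinuousLinearMap.adjoint_inner_right]
  simp only [fracAdj, ContinuousLinearMap.comp_apply, extendLp_mulExp_modVec]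
  rw [inner_mulExp, ← ContinuousLinearMap.adjoint_inner_right]
  change inner ℂ _ (extendLp volume (Set.Ioo 0 ω) _) = _
  rw [extendLp_mulExp_modVec, ← Lp.inner_fourier_eq, fourier_fourierMul, L2.inner_def,
    ← integral_sub_right_eq_self (fun η => conj (symb α (η + ξ)) * _) ξ]
  refine integral_congr_ae ?_
  filter_upwards [mulL_toLp_coeFn (memLp_symb α)
      (𝓕 ((memLp_box ω 1 ξ).toLp _) : Lp ℂ 2 (volume : Measure ℝ)),
    fourier_toLp_box_ae_eq ω 1 ξ, fourier_toLp_box_ae_eq ω (-1) ξ] with η h1 h2 h3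
  rw [h1, h2, h3, RCLike.inner_apply, map_mul, sub_add_cancel]
  ring

/-- By Plancherel this is an integral over `(0, ω)` in which the weights `e^t` and `e^{-t}` cancel.
-/
theorem integral_conj_fourier_box {ω : ℝ} (hω : 0 < ω) :
    ∫ η, conj (𝓕 (box ω 1 0) η) * 𝓕 (box ω (-1) 0) η = ω := by
  have h := Lp.inner_fourier_eq ((memLp_box ω 1 0).toLp _) ((memLp_box ω (-1) 0).toLp _)
  rw [L2.inner_def, inner_toLp_toLp] at h
  have h1 : ∫ x, conj (box ω 1 0 x) * box ω (-1) 0 x = ω := by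
    have : ∀ x, conj (box ω 1 0 x) * box ω (-1) 0 x =
        (Set.Ioo 0 ω).indicator (fun _ => (1 : ℂ)) x := by
      intro x
      by_cases hx : x ∈ Set.Ioo 0 ω
      · simp only [box, Set.indicator_of_mem hx, map_mul, Complex.conj_ofReal]
        rw [mul_mul_mul_comm, ← Complex.ofReal_mul, ← Real.exp_add]
        simp [modFun]
      · simp [box, Set.indicator_of_notMem hx]
    simp_rw [this]
    rw [integral_indicator measurableSet_Ioo, setIntegral_const]
    simp [hω.le]
  rw [← h1, ← h]
  refine integral_congr_ae ?_
  filter_upwards [fourier_toLp_ae_eq (integrable_box ω 1 0) (memLp_box ω 1 0),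
    fourier_toLp_ae_eq (integrable_box ω (-1) 0) (memLp_box ω (-1) 0)] with η h2 h3
  rw [h2, h3, RCLike.inner_apply, mul_comm]

theorem integrable_conj_fourier_box (ω : ℝ) :
    Integrable fun η => conj (𝓕 (box ω 1 0) η) * 𝓕 (box ω (-1) 0) η := by
  refine (L2.integrable_inner (𝕜 := ℂ)
    (𝓕 ((memLp_box ω 1 0).toLp _) : Lp ℂ 2 (volume : Measure ℝ))
    (𝓕 ((memLp_box ω (-1) 0).toLp _))).congr ?_
  filter_upwards [fourier_toLp_ae_eq (integrable_box ω 1 0) (memLp_box ω 1 0),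
    fourier_toLp_ae_eq (integrable_box ω (-1) 0) (memLp_box ω (-1) 0)] with η h2 h3
  rw [h2, h3, RCLike.inner_apply, mul_comm]

/-- A sequence of frequencies `ρ n → ∞` with `ρ n ^ (iα) = 1`. -/
def freq (α : ℝ) (n : ℕ) : ℝ := Real.exp (2 * Real.pi * n / |α|)

theorem freq_pos (α : ℝ) (n : ℕ) : 0 < freq α n := Real.exp_pos _

theorem tendsto_freq {α : ℝ} (hα : α ≠ 0) : Tendsto (freq α) atTop atTop := by
  refine Real.tendsto_exp_atTop.comp ?_
  refine Tendsto.atTop_div_const (abs_pos.2 hα) ?_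
  exact tendsto_natCast_atTop_atTop.const_mul_atTop Real.two_pi_pos

theorem exp_log_freq_mul {α : ℝ} (hα : α ≠ 0) (n : ℕ) :
    Complex.exp ((Real.log (freq α n) : ℂ) * (Complex.I * α)) = 1 := by
  have hα' : (α : ℂ) ≠ 0 := by exact_mod_cast hα
  rw [freq, Real.log_exp, Complex.exp_eq_one_iff]
  rcases abs_choice α with h | h
  · refine ⟨n, ?_⟩
    rw [h]
    push_cast
    field_simp
  · refine ⟨-n, ?_⟩
    rw [h]
    push_cast
    field_simp

/-- A positive factor splits off the principal logarithm, and `freq α n ^ (iα) = 1`; what remains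
converges as `n → ∞`. -/
theorem symb_add_freq {α : ℝ} (hα : α ≠ 0) (σ η : ℝ) (n : ℕ) :
    symb α (η + σ * freq α n) =
      (((freq α n)⁻¹ : ℝ) * (1 - 2 * Real.pi * η * Complex.I) -
        2 * Real.pi * σ * Complex.I : ℂ) ^ (Complex.I * (α : ℂ)) := by
  have hρ := freq_pos α n
  set w : ℂ := ((freq α n)⁻¹ : ℝ) * (1 - 2 * Real.pi * η * Complex.I) -
    2 * Real.pi * σ * Complex.I with hw
  have hz : (1 - 2 * Real.pi * ((η + σ * freq α n : ℝ) : ℂ) * Complex.I : ℂ) = freq α n * w := by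
    have : (freq α n : ℂ) ≠ 0 := by exact_mod_cast hρ.ne'
    rw [hw]
    push_cast
    field_simp
    ring
  have hne := one_sub_ne_zero (η + σ * freq α n)
  rw [hz] at hne
  have hw0 : w ≠ 0 := right_ne_zero_of_mul hne
  rw [symb, hz, Complex.cpow_def_of_ne_zero hne, Complex.cpow_def_of_ne_zero hw0,
    Complex.log_ofReal_mul hρ hw0, add_mul, Complex.exp_add, exp_log_freq_mul hα, one_mul]

theorem tendsto_symb_add_freq {α : ℝ} (hα : α ≠ 0) {σ : ℝ} (hσ : σ ≠ 0) (η : ℝ) :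
    Tendsto (fun n => symb α (η + σ * freq α n)) atTop
      (𝓝 ((((-(2 * Real.pi * σ) : ℝ) : ℂ) * Complex.I) ^ (Complex.I * (α : ℂ)))) := by
  simp_rw [symb_add_freq hα]
  -- The limit point `-2πσi` has nonzero imaginary part, so it avoids the branch cut.
  refine (continuousAt_cpow_const (Or.inr ?_)).tendsto.comp ?_
  · simp [Real.pi_ne_zero, hσ]
  · have h : Tendsto (fun n => (((freq α n)⁻¹ : ℝ) : ℂ)) atTop (𝓝 ((0 : ℝ) : ℂ)) :=
      (Complex.continuous_ofReal.tendsto 0).comp (tendsto_freq hα).inv_tendsto_atTop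
    have h' := (h.mul_const (1 - 2 * Real.pi * η * Complex.I : ℂ)).sub_const
      (2 * Real.pi * σ * Complex.I : ℂ)
    convert! h' using 2
    push_cast
    ring

theorem tendsto_inner_modVec_fracInt {ω α : ℝ} (hω : 0 < ω) (hα : α ≠ 0) {σ : ℝ} (hσ : σ ≠ 0) :
    Tendsto (fun n => inner ℂ (modVec ω (σ * freq α n))
        (fracInt ω α (modVec ω (σ * freq α n)))) atTop
      (𝓝 (conj ((((-(2 * Real.pi * σ) : ℝ) : ℂ) * Complex.I) ^ (Complex.I * (α : ℂ))) * ω)) := by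
  simp_rw [inner_modVec_fracInt]
  rw [← integral_conj_fourier_box hω, ← integral_const_mul]
  have hint := integrable_conj_fourier_box ω
  refine tendsto_integral_of_dominated_convergence
    (fun η => Real.exp (Real.pi * |α|) * ‖conj (𝓕 (box ω 1 0) η) * 𝓕 (box ω (-1) 0) η‖)
    (fun n => ?_) (hint.norm.const_mul _) (fun n => ?_) ?_
  · refine AEStronglyMeasurable.mul (Measurable.aestronglyMeasurable ?_) hint.1
    exact Complex.continuous_conj.measurable.comp
      ((measurable_symb α).comp (measurable_id.add_const _))
  · filter_upwards with η
    rw [norm_mul, RCLike.norm_conj]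
    gcongr
    exact norm_symb_le _ _
  · filter_upwards with η
    exact ((Complex.continuous_conj.tendsto _).comp
      (tendsto_symb_add_freq hα hσ η)).mul_const _

theorem norm_mul_I_cpow {r : ℝ} (hr : 0 < r) (α : ℝ) :
    ‖((r : ℂ) * Complex.I) ^ (Complex.I * (α : ℂ))‖ = Real.exp (-(Real.pi / 2 * α)) := by
  rw [Complex.norm_cpow_of_ne_zero (by simp [hr.ne']), Complex.arg_real_mul _ hr, Complex.arg_I]
  simp [Real.exp_neg]

theorem norm_neg_mul_I_cpow {r : ℝ} (hr : 0 < r) (α : ℝ) :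
    ‖(((-r : ℝ) : ℂ) * Complex.I) ^ (Complex.I * (α : ℂ))‖ = Real.exp (Real.pi / 2 * α) := by
  have h : ((-r : ℝ) : ℂ) * Complex.I = (r : ℂ) * (-Complex.I) := by push_cast; ring
  rw [h, Complex.norm_cpow_of_ne_zero (by simp [hr.ne']), Complex.arg_real_mul _ hr,
    Complex.arg_neg_I]
  simp [← Real.exp_neg]

/-- If `T` is the sum of an operator commuting with the chain `E_t` and a compact operator, then
the quadratic form of `T` converges along exponentials of high frequency, to a limit which does
not depend on the sequence of frequencies. -/
theorem tendsto_inner_modVec_add {ω : ℝ} (hω : 0 < ω) {S V : L2 ω →L[ℂ] L2 ω}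
    (hS : ∀ t ∈ Set.Ioo 0 ω, chainProj ω t * S = S * chainProj ω t) (hV : IsCompactOperator V)
    {ξ : ℕ → ℝ} (hξ : Tendsto ξ atTop (cocompact ℝ)) :
    Tendsto (fun n => inner ℂ (modVec ω (ξ n)) ((S + V) (modVec ω (ξ n)))) atTop
      (𝓝 (inner ℂ (modVec ω 0) (S (modVec ω 0)))) := by
  have hV0 := tendsto_zero_of_isCompactOperator hV (fun n => (norm_modVec ω (ξ n)).le)
    fun g => tendsto_inner_modVec ω g hξ
  have h : Tendsto (fun n => inner ℂ (modVec ω (ξ n)) (V (modVec ω (ξ n)))) atTop (𝓝 0) := by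
    refine squeeze_zero_norm (a := fun n => ‖modVec ω 0‖ * ‖V (modVec ω (ξ n))‖) (fun n => ?_) ?_
    · exact (norm_inner_le_norm _ _).trans_eq (by rw [norm_modVec])
    · simpa using hV0.norm.const_mul ‖modVec ω 0‖
  have h' := h.const_add (inner ℂ (modVec ω 0) (S (modVec ω 0)))
  rw [add_zero] at h'
  refine h'.congr fun n => ?_
  rw [add_apply, inner_add_right, inner_modVec_of_commute hω hS (ξ n)]

theorem fracInt_ne_add {ω α : ℝ} (hω : 0 < ω) (hα : α ≠ 0) {S V : L2 ω →L[ℂ] L2 ω}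
    (hS : ∀ t ∈ Set.Ioo 0 ω, chainProj ω t * S = S * chainProj ω t) (hV : IsCompactOperator V) :
    fracInt ω α ≠ S + V := by
  intro h
  have hpos : Tendsto (fun n => (1 : ℝ) * freq α n) atTop (cocompact ℝ) := by
    simp_rw [one_mul]
    exact (tendsto_freq hα).mono_right atTop_le_cocompact
  have hneg : Tendsto (fun n => (-1 : ℝ) * freq α n) atTop (cocompact ℝ) := by
    simp_rw [neg_one_mul]
    exact (tendsto_neg_atTop_atBot.comp (tendsto_freq hα)).mono_right atBot_le_cocompact
  have h1 := tendsto_nhds_unique (tendsto_inner_modVec_fracInt hω hα one_ne_zero)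
    (h ▸ tendsto_inner_modVec_add hω hS hV hpos)
  have h2 := tendsto_nhds_unique (tendsto_inner_modVec_fracInt hω hα (neg_ne_zero.2 one_ne_zero))
    (h ▸ tendsto_inner_modVec_add hω hS hV hneg)
  have h3 := mul_right_cancel₀ (Complex.ofReal_ne_zero.2 hω.ne') (h1.trans h2.symm)
  -- The arguments `∓π/2` of the bases for `σ = ±1` give moduli `e^{πα/2}` and `e^{-πα/2}`; equality
  -- would force `πα = 0`.
  have h4 := congrArg norm h3
  rw [RCLike.norm_conj, RCLike.norm_conj, mul_one, mul_neg_one, neg_neg,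
    norm_neg_mul_I_cpow Real.two_pi_pos, norm_mul_I_cpow Real.two_pi_pos, Real.exp_eq_exp] at h4
  have h5 : Real.pi * α = 0 := by linarith
  exact (mul_ne_zero Real.pi_ne_zero hα) h5

end Asymptotics

end SVTriangular

end

/-- For real `α ≠ 0` the fractional integral of order `iα` is a well-defined bounded operator on
`L²(0, ω)`, and it is not `(S + V)`-triangular with respect to the chain `E_t`, `0 ≤ t ≤ ω`. -/
theorem corollary5p9 (ω : ℝ) (hω : 0 < ω) (α : ℝ) (hα : α ≠ 0) :
    (∃! J : SVTriangular.L2 ω →L[ℂ] SVTriangular.L2 ω,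
      SVTriangular.IsImaginaryFractionalIntegral ω α J) ∧
    ∀ J : SVTriangular.L2 ω →L[ℂ] SVTriangular.L2 ω,
      SVTriangular.IsImaginaryFractionalIntegral ω α J →
      ¬ SVTriangular.IsSVTriangular (SVTriangular.chainProj ω) 0 ω J := by
  have hJ := SVTriangular.isImaginaryFractionalIntegral_fracInt hω α
  refine ⟨⟨_, hJ, fun J' hJ' => hJ'.unique hJ⟩, ?_⟩
  rintro J hJ' ⟨S, V, hrep, hV⟩
  exact SVTriangular.fracInt_ne_add hω hα hrep.commute hV ((hJ.unique hJ').trans hrep.eq_add)
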